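/- **Proposition 6.1.** Let $\Gamma\subset \mathrm{PSL}_2(\mathbb C)$ be a Kleinian group, that is, a subgroup acting discontinuously at some point of $\mathbb P^1$, where $\Gamma$ acts discontinuously at $z$ if there is a neighbourhood $W$ of $z$ with $\gamma(W)\cap W=\emptyset$ for all but finitely many $\gamma\in\Gamma$. Suppose that $\Gamma$ acts discontinuously at $\infty=[1:0]\in\mathbb P^1$. Let $\tau_*:\mathrm{PSL}_2(\mathbb C)\to \mathrm{PSL}_4(\mathbb C)=\mathrm{PGL}_4(\mathbb C)$ be the representation defined by the twisted cubic $\tau([s:t])=[s^3:s^2t:st^2:t^3]$, that is, $\tau\circ g=\tau_*(g)\circ\tau$; explicitly, $\tau_*$ sends the class of $\begin{pmatrix}a&b\\c&d\end{pmatrix}\in\mathrm{SL}_2(\mathbb C)$ to the class of $$\begin{pmatrix} a^3&3a^2b&3ab^2&b^3\\ a^2c&a^2d+2abc&2abd+b^2c&b^2d\\ ac^2&2acd+bc^2&ad^2+2bcd&bd^2\\ c^3&3c^2d&3cd^2&d^3\end{pmatrix}\in\mathrm{SL}_4(\mathbb C).$$ Put $\tilde\Gamma=\tau_*(\Gamma)$.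 For $g\in\tilde\Gamma$ let $C_g$ be the lower left $2\times2$ block of a representative of $g$ in $\mathrm{SL}_4(\mathbb C)$; whether $\det C_g\ne0$, and the number $\|C_g^{-1}\|$ (operator norm for the standard Hermitian norm on $\mathbb C^2$) if so, do not depend on the representative. Then: 1. For $\gamma\in\Gamma$ we have $\det C_{\tau_*(\gamma)}\neq 0$ if and only if $\gamma(\infty)\ne\infty$, and $\det C_g=0$ for only finitely many $g\in\tilde\Gamma$. In particular, if no element of $\Gamma\setminus\{1\}$ fixes $\infty$, then $\det C_g\ne0$ for every $g\in\tilde\Gamma\setminus\{1\}$. 2. Let $\tilde\Gamma^*=\{g\in\tilde\Gamma : g\neq1,\ \det C_g\ne 0\}$ (which is $\tilde\Gamma\setminus\{1\}$ if no element of $\Gamma\setminus\{1\}$ fixes $\infty$). For every real $\delta\ge4$ the series $$\sum_{g\in\tilde\Gamma^*}\|C_g^{-1}\|^{\delta}$$ converges. 3. The set $\mathcal R=\{\|C_g^{-1}\| : g\in\tilde\Gamma^*\}$ satisfies both of the following conditions: $(\clubsuit)$ $\mathcal R$ is bounded in $\mathbb R$; $(\spadesuit)$ $\mathcal R$ has no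 accumulation point in $\mathbb R$ other than $0$. -/

import Mathlib

open scoped MatrixGroups Topology

noncomputable section

namespace TwistedCubicKleinian

/-! ### Möbius transformations and Kleinian groups

The Riemann sphere `ℙ¹ = ℂ ∪ {∞}` is `OnePoint ℂ`, the point `[s : 1]` being `s` and the point
`[1 : 0]` being `∞`. -/

/-- The action of `PSL(2, ℂ)` on the Riemann sphere by Möbius transformations: the class of the
matrix with rows `(a, b)`, `(c, d)` acts as `z ↦ (a z + b) / (c z + d)`. -/
def moebius : PSL(2, ℂ) →* Equiv.Perm (OnePoint ℂ) :=
  QuotientGroup.lift (Subgroup.center SL(2, ℂ))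
    ((MulAction.toPermHom (GL (Fin 2) ℂ) (OnePoint ℂ)).comp Matrix.SpecialLinearGroup.toGL)
    (by
      intro M hM
      obtain ⟨r, hr, hM⟩ := Matrix.SpecialLinearGroup.mem_center_iff.1 hM
      have hr0 : r ≠ 0 := by rintro rfl; simp at hr
      have h00 : M 0 0 = r := by simp [← hM]
      have h01 : M 0 1 = 0 := by simp [← hM]
      have h10 : M 1 0 = 0 := by simp [← hM]
      have h11 : M 1 1 = r := by simp [← hM]
      rw [MonoidHom.mem_ker]
      ext z
      induction z using OnePoint.rec with
      | infty => simp [OnePoint.smul_infty_eq_ite, h10]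
      | coe z => simp [OnePoint.smul_some_eq_ite, h00, h01, h10, h11, hr0])

/-- `Γ` acts discontinuously at `z`: some neighbourhood `W` of `z` satisfies `γ(W) ∩ W = ∅` for all
but finitely many `γ ∈ Γ`. -/
def DiscontinuousAt (Γ : Subgroup PSL(2, ℂ)) (z : OnePoint ℂ) : Prop :=
  ∃ W ∈ 𝓝 z, {γ : PSL(2, ℂ) | γ ∈ Γ ∧ moebius γ '' W ∩ W ≠ ∅}.Finite

/-- The set of discontinuity of `Γ` in the Riemann sphere. -/
def discontinuitySet (Γ : Subgroup PSL(2, ℂ)) : Set (OnePoint ℂ) :=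
  {z | DiscontinuousAt Γ z}

/-- A Kleinian group is a subgroup of `PSL(2, ℂ)` acting discontinuously at some point of the
Riemann sphere. -/
def IsKleinian (Γ : Subgroup PSL(2, ℂ)) : Prop :=
  ∃ z, DiscontinuousAt Γ z

/-! ### The representation defined by the twisted cubic -/

/-- The matrix of the action on binary cubics that is attached to the matrix with rows `(a, b)`,
`(c, d)`. -/
def cubicMatrix (a b c d : ℂ) : Matrix (Fin 4) (Fin 4) ℂ :=
  !![a ^ 3, 3 * a ^ 2 * b, 3 * a * b ^ 2, b ^ 3;
     a ^ 2 * c, a ^ 2 * d + 2 * a * b * c, 2 * a * b * d + b ^ 2 * c, b ^ 2 * d;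
     a * c ^ 2, 2 * a * c * d + b * c ^ 2, a * d ^ 2 + 2 * b * c * d, b * d ^ 2;
     c ^ 3, 3 * c ^ 2 * d, 3 * c * d ^ 2, d ^ 3]

/-- The twisted cubic `τ([s : t]) = [s³ : s²t : st² : t³]` in homogeneous coordinates. -/
def twistedCubic (s t : ℂ) : Fin 4 → ℂ := ![s ^ 3, s ^ 2 * t, s * t ^ 2, t ^ 3]

/-- The equivariance `τ ∘ g = τ_*(g) ∘ τ` that characterizes the representation. -/
theorem cubicMatrix_mulVec (a b c d s t : ℂ) :
    (cubicMatrix a b c d).mulVec (twistedCubic s t) =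
      twistedCubic (a * s + b * t) (c * s + d * t) := by
  ext i
  fin_cases i <;>
    simp [cubicMatrix, twistedCubic, Matrix.mulVec, dotProduct, Fin.sum_univ_four] <;> ring

theorem cubicMatrix_det (a b c d : ℂ) :
    (cubicMatrix a b c d).det = (a * d - b * c) ^ 6 := by
  simp [cubicMatrix, Matrix.det_succ_row_zero, Fin.sum_univ_succ, Fin.succAbove]
  ring

theorem cubicMatrix_mul (a b c d a' b' c' d' : ℂ) :
    cubicMatrix (a * a' + b * c') (a * b' + b * d') (c * a' + d * c') (c * b' + d * d') =
      cubicMatrix a b c d * cubicMatrix a' b' c' d' := by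
  ext i j
  fin_cases i <;> fin_cases j <;>
    simp [cubicMatrix, Matrix.mul_apply, Fin.sum_univ_four] <;> ring

/-- The lift `SL(2, ℂ) → SL(4, ℂ)` of the representation. -/
def cubicLift : SL(2, ℂ) →* SL(4, ℂ) where
  toFun M := ⟨cubicMatrix (M 0 0) (M 0 1) (M 1 0) (M 1 1), by
    have h := M.det_coe
    rw [Matrix.det_fin_two] at h
    rw [cubicMatrix_det, h, one_pow]⟩
  map_one' := by
    ext i j
    fin_cases i <;> fin_cases j <;> simp [cubicMatrix]
  map_mul' M N := by
    have h (i j : Fin 2) : (M * N) i j = M i 0 * N 0 j + M i 1 * N 1 j := by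
      rw [Matrix.SpecialLinearGroup.coe_mul, Matrix.mul_apply, Fin.sum_univ_two]
    refine Subtype.ext (Eq.trans ?_ (cubicMatrix_mul _ _ _ _ _ _ _ _))
    simp only [h]

/-- The representation `τ_* : PSL(2, ℂ) → PSL(4, ℂ) = PGL(4, ℂ)`. -/
def cubicRep : PSL(2, ℂ) →* PSL(4, ℂ) :=
  QuotientGroup.map (Subgroup.center SL(2, ℂ)) (Subgroup.center SL(4, ℂ)) cubicLift (by
    intro M hM
    obtain ⟨r, hr, hM⟩ := Matrix.SpecialLinearGroup.mem_center_iff.1 hM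
    have hr2 : r ^ 2 = 1 := by simpa using hr
    rw [Subgroup.mem_comap]
    refine Matrix.SpecialLinearGroup.mem_center_iff.2 ⟨r ^ 3, ?_, ?_⟩
    · simp only [Fintype.card_fin]
      calc (r ^ 3) ^ 4 = (r ^ 2) ^ 6 := by ring
        _ = 1 := by rw [hr2, one_pow]
    · have h00 : M 0 0 = r := by simp [← hM]
      have h01 : M 0 1 = 0 := by simp [← hM]
      have h10 : M 1 0 = 0 := by simp [← hM]
      have h11 : M 1 1 = r := by simp [← hM]
      change Matrix.scalar (Fin 4) (r ^ 3) = cubicMatrix (M 0 0) (M 0 1) (M 1 0) (M 1 1)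
      rw [h00, h01, h10, h11]
      ext i j
      fin_cases i <;> fin_cases j <;> simp [cubicMatrix, pow_succ, mul_assoc])

/-! ### The lower left block and the conditions (♣), (♠) -/

/-- The lower left `2 × 2` block `C` of a `4 × 4` matrix with blocks `A, B; C, D`. -/
def blockC (M : Matrix (Fin 4) (Fin 4) ℂ) : Matrix (Fin 2) (Fin 2) ℂ :=
  !![M 2 0, M 2 1; M 3 0, M 3 1]

/-- The operator norm of a matrix with respect to the standard Hermitian norm of `ℂ²`. -/
def opNorm (A : Matrix (Fin 2) (Fin 2) ℂ) : ℝ :=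
  ‖Matrix.toEuclideanCLM (n := Fin 2) (𝕜 := ℂ) A‖

/-- `det C_g ≠ 0`, where `C_g` is the lower left block of a representative of `g` in `SL(4, ℂ)`;
representatives differ by scalar factors, so it does not matter which one is taken. -/
def NonsingularC (g : PSL(4, ℂ)) : Prop :=
  ∀ M : SL(4, ℂ), (M : PSL(4, ℂ)) = g → (blockC M).det ≠ 0

/-- Representatives of an element of `PSL(4, ℂ)` give the same norm of the inverse block. -/
theorem opNorm_inv_blockC_eq (M N : SL(4, ℂ)) (h : (M : PSL(4, ℂ)) = N) :
    opNorm (blockC M)⁻¹ = opNorm (blockC N)⁻¹ := by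
  have hc : M⁻¹ * N ∈ Subgroup.center SL(4, ℂ) := QuotientGroup.eq.1 h
  obtain ⟨r, hr, hz⟩ := Matrix.SpecialLinearGroup.mem_center_iff.1 hc
  have hr4 : r ^ 4 = 1 := by simpa using hr
  have hr0 : r ≠ 0 := by rintro rfl; simp at hr4
  have hn : ‖r‖ = 1 := by
    have := congrArg norm hr4
    rw [norm_pow, norm_one] at this
    exact (pow_eq_one_iff_of_nonneg (norm_nonneg r) (by norm_num)).1 this
  have hN : (N : Matrix (Fin 4) (Fin 4) ℂ) = r • (M : Matrix (Fin 4) (Fin 4) ℂ) := by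
    have : N = M * (M⁻¹ * N) := by group
    rw [this, Matrix.SpecialLinearGroup.coe_mul, ← hz, Matrix.scalar_apply,
      ← Matrix.smul_one_eq_diagonal, Matrix.mul_smul, Matrix.mul_one]
  have hb : blockC N = r • blockC M := by
    ext i j
    rw [hN]
    fin_cases i <;> fin_cases j <;> simp [blockC]
  have hinv : (blockC N)⁻¹ = r⁻¹ • (blockC M)⁻¹ := by
    rw [hb, Matrix.inv_def, Matrix.inv_def]
    ext i j
    fin_cases i <;> fin_cases j <;>
      simp [Matrix.adjugate_fin_two] <;> field_simp
  rw [hinv, opNorm, opNorm, map_smul, norm_smul, norm_inv, hn, inv_one, one_mul]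

/-- The number `‖C_g⁻¹‖`, where `C_g` is the lower left block of a representative of `g` in
`SL(4, ℂ)`. It is used only when `C_g` is invertible. -/
def normInvC : PSL(4, ℂ) → ℝ :=
  Quotient.lift (fun M : SL(4, ℂ) => opNorm (blockC M)⁻¹)
    (fun M N h => opNorm_inv_blockC_eq M N (Quotient.sound h))

/-- The elements `g ≠ 1` of `G` for which `C_g⁻¹` exists. -/
def starSet (G : Subgroup PSL(4, ℂ)) : Set PSL(4, ℂ) :=
  {g | g ∈ G ∧ g ≠ 1 ∧ NonsingularC g}

/-- The set `{‖C_g⁻¹‖ : g ∈ G, g ≠ 1, det C_g ≠ 0}` of real numbers. -/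
def radiusSet (G : Subgroup PSL(4, ℂ)) : Set ℝ := normInvC '' starSet G

/-- Condition (♣): the set of the numbers `‖C_g⁻¹‖` is bounded. -/
def ConditionClub (G : Subgroup PSL(4, ℂ)) : Prop :=
  Bornology.IsBounded (radiusSet G)

/-- Condition (♠): the set of the numbers `‖C_g⁻¹‖` has no accumulation point other than `0`. -/
def ConditionSpade (G : Subgroup PSL(4, ℂ)) : Prop :=
  ∀ x : ℝ, AccPt x (Filter.principal (radiusSet G)) → x = 0

end TwistedCubicKleinian

end

namespace TwistedCubicKleinian

/-! ### The Möbius action on representatives -/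

/-! For `γ` with rows `(a, b)`, `(c, d)` and `ad - bc = 1`, the block has determinant `c ^ 4`, and
`c • C⁻¹` has entries polynomial in `a/c = γ(∞)`, `d/c = -γ⁻¹(∞)` and `1/c²`
(`inv_blockC_cubicLift`). Let `W` be a neighbourhood of `∞` witnessing discontinuity, containing
`|z| > R`. For all but finitely many `γ`, `γ(W)` misses `W`; then these three quantities are
bounded, so `‖C⁻¹‖` is at most a constant times `|c|⁻¹`. It remains to sum `|c|⁻⁴`, by an area
argument: `γ(W)` contains a disc about `a/c` of area proportional to `|c|⁻⁴`
(`ball_subset_moebius_image_of_disjoint`), all these discs lie in `|z| ≤ R`, and they overlap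
boundedly often because only finitely many `γ` fail to move `W` off itself
(`summable_inv_norm_pow_four`). Convergence at exponent 4 makes `‖C_g⁻¹‖` tend to 0 along the
cofinite filter, which gives larger exponents, (♣) and (♠). -/

theorem moebius_mk_infty (M : SL(2, ℂ)) :
    moebius (M : PSL(2, ℂ)) OnePoint.infty =
      if M 1 0 = 0 then OnePoint.infty else ((M 0 0 / M 1 0 : ℂ) : OnePoint ℂ) :=
  OnePoint.smul_infty_eq_ite (M : GL (Fin 2) ℂ)

theorem moebius_mk_coe (M : SL(2, ℂ)) (z : ℂ) :
    moebius (M : PSL(2, ℂ)) z =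
      if M 1 0 * z + M 1 1 = 0 then OnePoint.infty
      else (((M 0 0 * z + M 0 1) / (M 1 0 * z + M 1 1) : ℂ) : OnePoint ℂ) :=
  OnePoint.smul_some_eq_ite (g := (M : GL (Fin 2) ℂ))

theorem moebius_mk_infty_ne_iff (M : SL(2, ℂ)) :
    moebius (M : PSL(2, ℂ)) OnePoint.infty ≠ OnePoint.infty ↔ M 1 0 ≠ 0 := by
  rw [moebius_mk_infty]
  split_ifs with h <;> simp [h]

theorem moebius_mk_inv_infty (M : SL(2, ℂ)) (hc : M 1 0 ≠ 0) :
    moebius (M : PSL(2, ℂ))⁻¹ OnePoint.infty = ((-(M 1 1 / M 1 0) : ℂ) : OnePoint ℂ) := by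
  rw [← QuotientGroup.mk_inv, moebius_mk_infty]
  simp [Matrix.SpecialLinearGroup.SL2_inv_expl, hc, div_neg]

theorem moebius_mk_inv_coe (M : SL(2, ℂ)) (w : ℂ) :
    moebius (M : PSL(2, ℂ))⁻¹ w =
      if M 0 0 - M 1 0 * w = 0 then OnePoint.infty
      else (((M 1 1 * w - M 0 1) / (M 0 0 - M 1 0 * w) : ℂ) : OnePoint ℂ) := by
  rw [← QuotientGroup.mk_inv, moebius_mk_coe]
  simp only [Matrix.SpecialLinearGroup.SL2_inv_expl]
  simp [neg_add_eq_sub, ← sub_eq_add_neg]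

theorem det_fin_two_eq_one (M : SL(2, ℂ)) : M 0 0 * M 1 1 - M 0 1 * M 1 0 = 1 := by
  rw [← Matrix.det_fin_two, M.det_coe]

/-! ### The lower left block -/

theorem exists_blockC_eq_smul {M N : SL(4, ℂ)} (h : (M : PSL(4, ℂ)) = N) :
    ∃ r : ℂ, r ≠ 0 ∧ blockC N = r • blockC M := by
  have hc : M⁻¹ * N ∈ Subgroup.center SL(4, ℂ) := QuotientGroup.eq.1 h
  obtain ⟨r, hr, hz⟩ := Matrix.SpecialLinearGroup.mem_center_iff.1 hc
  have hr0 : r ≠ 0 := by rintro rfl; simp at hr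
  refine ⟨r, hr0, ?_⟩
  have hN : (N : Matrix (Fin 4) (Fin 4) ℂ) = r • (M : Matrix (Fin 4) (Fin 4) ℂ) := by
    have : N = M * (M⁻¹ * N) := by group
    rw [this, Matrix.SpecialLinearGroup.coe_mul, ← hz, Matrix.scalar_apply,
      ← Matrix.smul_one_eq_diagonal, Matrix.mul_smul, Matrix.mul_one]
  ext i j
  rw [hN]
  fin_cases i <;> fin_cases j <;> simp [blockC]

theorem nonsingularC_mk_iff (M : SL(4, ℂ)) :
    NonsingularC (M : PSL(4, ℂ)) ↔ (blockC M).det ≠ 0 := by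
  refine ⟨fun h => h M rfl, fun h N hN => ?_⟩
  obtain ⟨r, hr, hb⟩ := exists_blockC_eq_smul hN.symm
  rw [hb, Matrix.det_smul]
  exact mul_ne_zero (pow_ne_zero _ hr) h

theorem blockC_cubicLift (M : SL(2, ℂ)) :
    blockC (cubicLift M) =
      !![M 0 0 * M 1 0 ^ 2, 2 * M 0 0 * M 1 0 * M 1 1 + M 0 1 * M 1 0 ^ 2;
         M 1 0 ^ 3, 3 * M 1 0 ^ 2 * M 1 1] :=
  rfl

theorem det_blockC_cubicLift (M : SL(2, ℂ)) : (blockC (cubicLift M)).det = M 1 0 ^ 4 := by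
  rw [blockC_cubicLift, Matrix.det_fin_two_of]
  linear_combination M 1 0 ^ 4 * det_fin_two_eq_one M

theorem nonsingularC_cubicRep_iff (γ : PSL(2, ℂ)) :
    NonsingularC (cubicRep γ) ↔ moebius γ OnePoint.infty ≠ OnePoint.infty := by
  induction γ using QuotientGroup.induction_on with
  | H M =>
    rw [moebius_mk_infty_ne_iff]
    refine (nonsingularC_mk_iff (cubicLift M)).trans ?_
    rw [det_blockC_cubicLift, pow_ne_zero_iff (by norm_num)]

/-- The relation `ad - bc = 1` eliminates `b`, leaving only `a/c`, `d/c` and `1/c²` after `c⁻¹` is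
factored out. -/
theorem inv_blockC_cubicLift (M : SL(2, ℂ)) (hc : M 1 0 ≠ 0) :
    (blockC (cubicLift M))⁻¹ = (M 1 0)⁻¹ •
      !![3 * (M 1 1 / M 1 0), 1 / M 1 0 ^ 2 - 3 * (M 0 0 / M 1 0) * (M 1 1 / M 1 0);
         -1, M 0 0 / M 1 0] := by
  have h := det_fin_two_eq_one M
  rw [Matrix.inv_def, det_blockC_cubicLift, blockC_cubicLift, Matrix.adjugate_fin_two_of,
    Ring.inverse_eq_inv']
  ext i j
  fin_cases i <;> fin_cases j <;> simp <;> field_simp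
  linear_combination h

theorem opNorm_le_sum_norm (A : Matrix (Fin 2) (Fin 2) ℂ) :
    opNorm A ≤ ∑ i, ∑ j, ‖A i j‖ := by
  refine ContinuousLinearMap.opNorm_le_bound _ (by positivity) fun x => ?_
  calc ‖Matrix.toEuclideanCLM (n := Fin 2) (𝕜 := ℂ) A x‖
      ≤ ∑ i, ‖(Matrix.toEuclideanCLM (n := Fin 2) (𝕜 := ℂ) A x) i‖ := by
        rw [EuclideanSpace.norm_eq]
        refine (Real.sqrt_le_left (by positivity)).2 ?_
        exact Finset.sum_sq_le_sq_sum_of_nonneg fun i _ => norm_nonneg _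
    _ ≤ ∑ i, ∑ j, ‖A i j‖ * ‖x‖ := by
        refine Finset.sum_le_sum fun i _ => ?_
        rw [Matrix.ofLp_toEuclideanCLM]
        refine (norm_sum_le Finset.univ fun j => A i j * x j).trans (Finset.sum_le_sum fun j _ => ?_)
        rw [norm_mul]
        exact mul_le_mul_of_nonneg_left (PiLp.norm_apply_le x j) (norm_nonneg _)
    _ = (∑ i, ∑ j, ‖A i j‖) * ‖x‖ := by simp_rw [Finset.sum_mul]

theorem normInvC_nonneg (g : PSL(4, ℂ)) : 0 ≤ normInvC g := by
  induction g using QuotientGroup.induction_on with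
  | H M => exact norm_nonneg _

theorem normInvC_cubicRep_mk_le (M : SL(2, ℂ)) (hc : M 1 0 ≠ 0) {R : ℝ}
    (hp : ‖M 0 0 / M 1 0‖ ≤ R) (hq : ‖M 1 1 / M 1 0‖ ≤ R) (hcR : 1 / ‖M 1 0‖ ^ 2 ≤ 8 * R ^ 2) :
    normInvC (cubicRep (M : PSL(2, ℂ))) ≤ (1 + 4 * R + 11 * R ^ 2) * ‖M 1 0‖⁻¹ := by
  change opNorm (blockC (cubicLift M))⁻¹ ≤ _
  rw [inv_blockC_cubicLift M hc]
  refine (opNorm_le_sum_norm _).trans ?_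
  simp only [Fin.sum_univ_two, Matrix.smul_apply, norm_smul, norm_inv, ← mul_add]
  rw [mul_comm]
  refine mul_le_mul_of_nonneg_right ?_ (by positivity)
  -- Here 11 = 8 + 3, with 8 coming from the bound on `1/|c|²`.
  have h01 : ‖1 / M 1 0 ^ 2 - 3 * (M 0 0 / M 1 0) * (M 1 1 / M 1 0)‖ ≤ 11 * R ^ 2 := by
    refine (norm_sub_le _ _).trans ?_
    rw [norm_mul, norm_mul, norm_div, norm_pow, norm_one, Complex.norm_ofNat]
    have := mul_le_mul hp hq (norm_nonneg _) ((norm_nonneg _).trans hp)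
    linarith
  have h00 : ‖3 * (M 1 1 / M 1 0)‖ ≤ 3 * R := by
    rw [norm_mul, Complex.norm_ofNat]; linarith
  simp only [Matrix.of_apply, Matrix.cons_val', Matrix.cons_val_zero, Matrix.cons_val_one,
    Matrix.cons_val_fin_one, norm_neg, norm_one]
  linarith

/-! ### Summability from bounded overlap -/

/-- Any finite sum of the indicators of the `B i` is at most `n` on `K` and vanishes off `K`, so
finite sums of measures are at most `n * μ K`. -/
theorem summable_measureReal_of_bounded_overlap {ι α : Type*} [MeasurableSpace α]
    (μ : MeasureTheory.Measure α) (B : ι → Set α) (hB : ∀ i, MeasurableSet (B i)) {K : Set α}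
    (hK : MeasurableSet K) (hμK : μ K ≠ ⊤) (hBK : ∀ i, B i ⊆ K) (n : ℕ)
    (hn : ∀ (x : α) (s : Finset ι), (∀ i ∈ s, x ∈ B i) → s.card ≤ n) :
    Summable fun i => μ.real (B i) := by
  classical
  refine ENNReal.summable_toReal (ne_top_of_le_ne_top
    (ENNReal.mul_ne_top (ENNReal.natCast_ne_top n) hμK) ?_)
  rw [ENNReal.tsum_eq_iSup_sum]
  refine iSup_le fun s => ?_
  calc ∑ i ∈ s, μ (B i) = ∫⁻ x, ∑ i ∈ s, (B i).indicator 1 x ∂μ := by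
        rw [MeasureTheory.lintegral_finsetSum _
          fun i _ => measurable_one.indicator (hB i)]
        exact Finset.sum_congr rfl fun i _ => (MeasureTheory.lintegral_indicator_one (hB i)).symm
    _ ≤ ∫⁻ x, K.indicator (fun _ => (n : ENNReal)) x ∂μ := by
        refine MeasureTheory.lintegral_mono fun x => ?_
        by_cases hx : x ∈ K
        · rw [Set.indicator_of_mem hx]
          simp only [Set.indicator_apply, Pi.one_apply, Finset.sum_boole]
          exact_mod_cast hn x _ fun i hi => (Finset.mem_filter.1 hi).2
        · rw [Finset.sum_eq_zero]
          · exact zero_le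
          · exact fun i _ => Set.indicator_of_notMem (fun h => hx (hBK i h)) _
    _ = n * μ K := MeasureTheory.lintegral_indicator_const hK _

/-! ### Elements moving a neighbourhood of infinity off itself -/

theorem exists_norm_lt_mem_of_mem_nhds_infty {W : Set (OnePoint ℂ)}
    (hW : W ∈ 𝓝 (OnePoint.infty : OnePoint ℂ)) :
    ∃ R : ℝ, 0 < R ∧ ∀ z : ℂ, R < ‖z‖ → (z : OnePoint ℂ) ∈ W := by
  have h := OnePoint.tendsto_coe_infty (X := ℂ) hW
  rw [Filter.coclosedCompact_eq_cocompact, Filter.mem_map,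
    Metric.mem_cocompact_iff_closedBall_compl_subset (0 : ℂ)] at h
  obtain ⟨r, hr⟩ := h
  refine ⟨max r 1, by positivity, fun z hz => hr ?_⟩
  simpa using (le_max_left r 1).trans_lt hz

theorem moebius_image_inter_nonempty_of_mem {γ γ' : PSL(2, ℂ)} {W : Set (OnePoint ℂ)}
    {w : OnePoint ℂ} (h : w ∈ moebius γ '' W) (h' : w ∈ moebius γ' '' W) :
    moebius (γ⁻¹ * γ') '' W ∩ W ≠ ∅ := by
  obtain ⟨z, hz, rfl⟩ := h
  obtain ⟨z', hz', he⟩ := h'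
  refine Set.Nonempty.ne_empty ⟨z, ⟨z', hz', ?_⟩, hz⟩
  rw [map_mul, map_inv, Equiv.Perm.mul_apply, he]
  exact (moebius γ).symm_apply_apply z

theorem mem_moebius_image_iff {γ : PSL(2, ℂ)} {W : Set (OnePoint ℂ)} {w : OnePoint ℂ} :
    w ∈ moebius γ '' W ↔ moebius γ⁻¹ w ∈ W := by
  rw [map_inv, Equiv.image_eq_preimage_symm]
  rfl

section Disjoint

variable {W : Set (OnePoint ℂ)} {R : ℝ} {M : SL(2, ℂ)}

theorem lowerLeft_ne_zero_of_disjoint (hinf : OnePoint.infty ∈ W)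
    (hM : moebius (M : PSL(2, ℂ)) '' W ∩ W = ∅) : M 1 0 ≠ 0 := by
  intro h
  have : OnePoint.infty ∈ moebius (M : PSL(2, ℂ)) '' W ∩ W :=
    ⟨⟨OnePoint.infty, hinf, by rw [moebius_mk_infty, if_pos h]⟩, hinf⟩
  simp [hM] at this

theorem norm_pole_image_le_of_disjoint (hinf : OnePoint.infty ∈ W)
    (hW : ∀ z : ℂ, R < ‖z‖ → (z : OnePoint ℂ) ∈ W)
    (hM : moebius (M : PSL(2, ℂ)) '' W ∩ W = ∅) : ‖M 0 0 / M 1 0‖ ≤ R := by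
  by_contra! h
  have : ((M 0 0 / M 1 0 : ℂ) : OnePoint ℂ) ∈ moebius (M : PSL(2, ℂ)) '' W ∩ W :=
    ⟨⟨OnePoint.infty, hinf, by
      rw [moebius_mk_infty, if_neg (lowerLeft_ne_zero_of_disjoint hinf hM)]⟩, hW _ h⟩
  simp [hM] at this

/-- The pole `-d/c` is `γ⁻¹(∞)`; were it in `W`, then `∞` would lie in `γ(W) ∩ W`. -/
theorem norm_pole_le_of_disjoint (hinf : OnePoint.infty ∈ W)
    (hW : ∀ z : ℂ, R < ‖z‖ → (z : OnePoint ℂ) ∈ W)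
    (hM : moebius (M : PSL(2, ℂ)) '' W ∩ W = ∅) : ‖M 1 1 / M 1 0‖ ≤ R := by
  by_contra! h
  have : OnePoint.infty ∈ moebius (M : PSL(2, ℂ)) '' W ∩ W := by
    refine ⟨mem_moebius_image_iff.2 ?_, hinf⟩
    rw [moebius_mk_inv_infty M (lowerLeft_ne_zero_of_disjoint hinf hM)]
    exact hW _ (by rwa [norm_neg])
  simp [hM] at this

/-- From `γ⁻¹(w) + d/c = 1 / (c² (a/c - w))`, the radius is chosen to make the right side exceed
`2R` in modulus. As `|d/c| ≤ R`, this leaves `|γ⁻¹(w)| > R`. -/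
theorem ball_subset_moebius_image_of_disjoint (hR : 0 < R) (hinf : OnePoint.infty ∈ W)
    (hW : ∀ z : ℂ, R < ‖z‖ → (z : OnePoint ℂ) ∈ W)
    (hM : moebius (M : PSL(2, ℂ)) '' W ∩ W = ∅) {w : ℂ}
    (hw : w ∈ Metric.ball (M 0 0 / M 1 0) (1 / (2 * R * ‖M 1 0‖ ^ 2))) :
    (w : OnePoint ℂ) ∈ moebius (M : PSL(2, ℂ)) '' W := by
  have hc := lowerLeft_ne_zero_of_disjoint hinf hM
  rw [mem_moebius_image_iff, moebius_mk_inv_coe]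
  split_ifs with h0
  · exact hinf
  refine hW _ ?_
  have hpole := norm_pole_le_of_disjoint hinf hW hM
  have hdet := det_fin_two_eq_one M
  have hpw : M 0 0 / M 1 0 - w ≠ 0 := by
    intro h
    apply h0
    field_simp at h
    linear_combination h
  have key : 2 * R < ‖(M 1 1 * w - M 0 1) / (M 0 0 - M 1 0 * w) + M 1 1 / M 1 0‖ := by
    have : (M 1 1 * w - M 0 1) / (M 0 0 - M 1 0 * w) + M 1 1 / M 1 0 =
        1 / (M 1 0 ^ 2 * (M 0 0 / M 1 0 - w)) := by
      have e : M 1 0 ^ 2 * (M 0 0 / M 1 0 - w) = M 1 0 * (M 0 0 - M 1 0 * w) := by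
        field_simp
      rw [e, div_add_div _ _ h0 hc, div_eq_div_iff (mul_ne_zero h0 hc) (mul_ne_zero hc h0)]
      linear_combination M 1 0 * (M 0 0 - M 1 0 * w) * hdet
    rw [this, norm_div, norm_one, norm_mul, norm_pow]
    rw [Metric.mem_ball, dist_comm, dist_eq_norm, lt_div_iff₀ (by positivity)] at hw
    rw [lt_div_iff₀ (by positivity)]
    linarith
  have := norm_add_le ((M 1 1 * w - M 0 1) / (M 0 0 - M 1 0 * w)) (M 1 1 / M 1 0)
  linarith

theorem ball_subset_closedBall_of_disjoint (hR : 0 < R) (hinf : OnePoint.infty ∈ W)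
    (hW : ∀ z : ℂ, R < ‖z‖ → (z : OnePoint ℂ) ∈ W)
    (hM : moebius (M : PSL(2, ℂ)) '' W ∩ W = ∅) :
    Metric.ball (M 0 0 / M 1 0) (1 / (2 * R * ‖M 1 0‖ ^ 2)) ⊆ Metric.closedBall 0 R := by
  intro w hw
  rw [mem_closedBall_zero_iff]
  by_contra! h
  have : (w : OnePoint ℂ) ∈ moebius (M : PSL(2, ℂ)) '' W ∩ W :=
    ⟨ball_subset_moebius_image_of_disjoint hR hinf hW hM hw, hW _ h⟩
  simp [hM] at this

theorem one_div_norm_sq_le_of_disjoint (hR : 0 < R) (hinf : OnePoint.infty ∈ W)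
    (hW : ∀ z : ℂ, R < ‖z‖ → (z : OnePoint ℂ) ∈ W)
    (hM : moebius (M : PSL(2, ℂ)) '' W ∩ W = ∅) : 1 / ‖M 1 0‖ ^ 2 ≤ 8 * R ^ 2 := by
  have hc : 0 < ‖M 1 0‖ := norm_pos_iff.2 (lowerLeft_ne_zero_of_disjoint hinf hM)
  set r : ℝ := 1 / (2 * R * ‖M 1 0‖ ^ 2) with hr
  have hr0 : 0 < r := by positivity
  have hnr : ‖((r / 2 : ℝ) : ℂ)‖ = r / 2 := by
    rw [Complex.norm_real, Real.norm_of_nonneg (by positivity)]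
  have h := ball_subset_closedBall_of_disjoint hR hinf hW hM
    (show M 0 0 / M 1 0 + ((r / 2 : ℝ) : ℂ) ∈ _ by
      rw [Metric.mem_ball, dist_eq_norm, add_sub_cancel_left, hnr, ← hr]
      linarith)
  rw [mem_closedBall_zero_iff] at h
  have hp := norm_pole_image_le_of_disjoint hinf hW hM
  -- The centre and a point at distance `r / 2` from it both lie in the closed disc of radius `R`.
  have h2 : r / 2 ≤ 2 * R := by
    have := norm_sub_le (M 0 0 / M 1 0 + ((r / 2 : ℝ) : ℂ)) (M 0 0 / M 1 0)
    rw [add_sub_cancel_left, hnr] at this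
    linarith
  have e : 1 / ‖M 1 0‖ ^ 2 = r / 2 * (4 * R) := by rw [hr]; field_simp; norm_num
  rw [e]
  nlinarith

end Disjoint

/-! ### Convergence of the series -/

theorem summable_inv_norm_pow_four (Γ : Subgroup PSL(2, ℂ)) {W : Set (OnePoint ℂ)} {R : ℝ}
    (hR : 0 < R) (hinf : OnePoint.infty ∈ W) (hW : ∀ z : ℂ, R < ‖z‖ → (z : OnePoint ℂ) ∈ W)
    (hfin : {γ : PSL(2, ℂ) | γ ∈ Γ ∧ moebius γ '' W ∩ W ≠ ∅}.Finite)
    {ι : Type*} (rep : ι → SL(2, ℂ))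
    (hinj : Function.Injective fun i => (rep i : PSL(2, ℂ)))
    (hrep : ∀ i, (rep i : PSL(2, ℂ)) ∈ Γ)
    (hdisj : ∀ i, moebius (rep i : PSL(2, ℂ)) '' W ∩ W = ∅) :
    Summable fun i => ‖rep i 1 0‖⁻¹ ^ 4 := by
  classical
  have hvol := summable_measureReal_of_bounded_overlap MeasureTheory.volume
    (fun i => Metric.ball (rep i 0 0 / rep i 1 0) (1 / (2 * R * ‖rep i 1 0‖ ^ 2)))
    (fun i => measurableSet_ball) (K := Metric.closedBall 0 R) measurableSet_closedBall
    MeasureTheory.measure_closedBall_lt_top.ne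
    (fun i => ball_subset_closedBall_of_disjoint hR hinf hW (hdisj i)) hfin.toFinset.card (by
      intro x s hs
      rcases s.eq_empty_or_nonempty with rfl | ⟨i₀, hi₀⟩
      · simp
      have hmem (i) (hi : i ∈ s) : (x : OnePoint ℂ) ∈ moebius (rep i : PSL(2, ℂ)) '' W :=
        ball_subset_moebius_image_of_disjoint hR hinf hW (hdisj i) (hs i hi)
      -- Translating by the inverse of one fixed element sends all elements whose discs contain `x`
      -- injectively into the finite exceptional set.
      refine Finset.card_le_card_of_injOn
        (fun i => (rep i₀ : PSL(2, ℂ))⁻¹ * (rep i : PSL(2, ℂ))) (fun i hi => ?_)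
        fun i _ j _ hij => hinj (mul_left_cancel hij)
      rw [Finset.mem_coe, Set.Finite.mem_toFinset]
      exact ⟨Γ.mul_mem (Γ.inv_mem (hrep i₀)) (hrep i),
        moebius_image_inter_nonempty_of_mem (hmem i₀ hi₀) (hmem i hi)⟩)
  -- The disc has area `π / (4 R² |c|⁴)`.
  refine (hvol.mul_left (4 * R ^ 2 / Real.pi)).congr fun i => ?_
  have hc : 0 < ‖rep i 1 0‖ := norm_pos_iff.2 (lowerLeft_ne_zero_of_disjoint hinf (hdisj i))
  rw [MeasureTheory.measureReal_def, Complex.volume_ball, ENNReal.toReal_mul, ENNReal.toReal_pow,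
    ENNReal.toReal_ofReal (by positivity)]
  simp only [ENNReal.coe_toReal, NNReal.coe_real_pi]
  field_simp
  norm_num

/-- The sum runs over all of `Γ`. Singular blocks, whose matrix inverse is 0 by convention, occur
only in the finite set discarded at the start. -/
theorem summable_normInvC_cubicRep_pow_four (Γ : Subgroup PSL(2, ℂ))
    (hΓ : OnePoint.infty ∈ discontinuitySet Γ) :
    Summable fun γ : Γ => normInvC (cubicRep γ) ^ 4 := by
  obtain ⟨W, hW, hfin⟩ := hΓ
  have hinf : OnePoint.infty ∈ W := mem_of_mem_nhds hW
  obtain ⟨R, hR, hRW⟩ := exists_norm_lt_mem_of_mem_nhds_infty hW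
  have hfin' : {γ : Γ | moebius (γ : PSL(2, ℂ)) '' W ∩ W ≠ ∅}.Finite :=
    (hfin.preimage (Subtype.val_injective.injOn)).subset fun γ hγ => ⟨γ.2, hγ⟩
  rw [← hfin'.summable_compl_iff]
  have hmk (γ : PSL(2, ℂ)) : ((Quotient.out γ : SL(2, ℂ)) : PSL(2, ℂ)) = γ :=
    QuotientGroup.out_eq' γ
  have hd (γ : ({γ : Γ | moebius (γ : PSL(2, ℂ)) '' W ∩ W ≠ ∅}ᶜ : Set Γ)) :
      moebius ((Quotient.out (γ : PSL(2, ℂ)) : SL(2, ℂ)) : PSL(2, ℂ)) '' W ∩ W = ∅ := by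
    rw [hmk]
    exact not_not.1 γ.2
  have hs := summable_inv_norm_pow_four Γ hR hinf hRW hfin
    (fun γ : ({γ : Γ | moebius (γ : PSL(2, ℂ)) '' W ∩ W ≠ ∅}ᶜ : Set Γ) =>
      (Quotient.out (γ : PSL(2, ℂ)) : SL(2, ℂ)))
    (fun γ γ' h => by
      simp only [hmk] at h
      exact Subtype.ext (Subtype.ext h))
    (fun γ => by rw [hmk]; exact γ.1.2) hd
  refine Summable.of_nonneg_of_le (fun γ => pow_nonneg (normInvC_nonneg _) 4) (fun γ => ?_)
    (hs.mul_left ((1 + 4 * R + 11 * R ^ 2) ^ 4))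
  have hle := normInvC_cubicRep_mk_le (Quotient.out (γ : PSL(2, ℂ)) : SL(2, ℂ))
    (lowerLeft_ne_zero_of_disjoint hinf (hd γ)) (norm_pole_image_le_of_disjoint hinf hRW (hd γ))
    (norm_pole_le_of_disjoint hinf hRW (hd γ)) (one_div_norm_sq_le_of_disjoint hR hinf hRW (hd γ))
  rw [hmk] at hle
  rw [Function.comp_apply, ← mul_pow]
  exact pow_le_pow_left₀ (normInvC_nonneg _) hle 4

theorem summable_normInvC_starSet_pow_four (Γ : Subgroup PSL(2, ℂ))
    (hΓ : OnePoint.infty ∈ discontinuitySet Γ) :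
    Summable fun g : starSet (Γ.map cubicRep) => normInvC (g : PSL(4, ℂ)) ^ 4 := by
  have hex (g : starSet (Γ.map cubicRep)) : ∃ γ : Γ, cubicRep γ = g := by
    obtain ⟨γ, hγ, h⟩ := g.2.1
    exact ⟨⟨γ, hγ⟩, h⟩
  -- Choosing preimages gives an injection into `Γ`, so injectivity of `cubicRep` is not needed.
  choose f hf using hex
  have hinj : Function.Injective f := fun g g' h => Subtype.ext (by rw [← hf g, ← hf g', h])
  refine ((summable_normInvC_cubicRep_pow_four Γ hΓ).comp_injective hinj).congr fun g => ?_
  rw [Function.comp_apply, hf]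

/-- A singular block means `γ` fixes `∞ ∈ W`, so `γ` is exceptional for `W`. -/
theorem finite_not_nonsingularC (Γ : Subgroup PSL(2, ℂ))
    (hΓ : OnePoint.infty ∈ discontinuitySet Γ) :
    {g : PSL(4, ℂ) | g ∈ Γ.map cubicRep ∧ ¬ NonsingularC g}.Finite := by
  obtain ⟨W, hW, hfin⟩ := hΓ
  refine (hfin.image cubicRep).subset ?_
  rintro _ ⟨⟨γ, hγ, rfl⟩, hg⟩
  rw [nonsingularC_cubicRep_iff, not_not] at hg
  have hinf : OnePoint.infty ∈ W := mem_of_mem_nhds hW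
  exact ⟨γ, ⟨hγ, Set.Nonempty.ne_empty
    ⟨OnePoint.infty, ⟨OnePoint.infty, hinf, hg⟩, hinf⟩⟩, rfl⟩

/-- All but finitely many terms are below 1, where raising the exponent can only decrease them. -/
theorem summable_rpow_of_summable_pow {ι : Type*} {f : ι → ℝ} (hf : ∀ i, 0 ≤ f i) {n : ℕ}
    (hn : n ≠ 0) (h : Summable fun i => f i ^ n) {δ : ℝ} (hδ : n ≤ δ) :
    Summable fun i => f i ^ δ := by
  refine Summable.of_norm_bounded_eventually h ?_
  filter_upwards [h.tendsto_cofinite_zero.eventually (gt_mem_nhds one_pos)] with i hi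
  have h1 : f i ≤ 1 := ((pow_lt_one_iff_of_nonneg (hf i) hn).1 hi).le
  rw [Real.norm_of_nonneg (Real.rpow_nonneg (hf i) δ), ← Real.rpow_natCast]
  exact Real.rpow_le_rpow_of_exponent_ge' (hf i) h1 (Nat.cast_nonneg n) hδ

theorem tendsto_cofinite_zero_of_summable_pow {ι : Type*} {f : ι → ℝ} (hf : ∀ i, 0 ≤ f i) {n : ℕ}
    (hn : n ≠ 0) (h : Summable fun i => f i ^ n) : Filter.Tendsto f Filter.cofinite (𝓝 0) := by
  refine tendsto_order.2 ⟨fun a ha => .of_forall fun i => ha.trans_le (hf i), fun a ha => ?_⟩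
  filter_upwards [h.tendsto_cofinite_zero.eventually (gt_mem_nhds (pow_pos ha n))] with i hi
  exact (pow_lt_pow_iff_left₀ (hf i) ha.le hn).1 hi

/-- If `x ≠ 0`, separate `x` from 0: a neighbourhood of 0 absorbs all but finitely many indices, so
only finitely many values remain near `x`. -/
theorem eq_zero_of_accPt_range {ι : Type*} {f : ι → ℝ}
    (h : Filter.Tendsto f Filter.cofinite (𝓝 0)) {x : ℝ}
    (hx : AccPt x (Filter.principal (Set.range f))) : x = 0 := by
  by_contra hx0
  obtain ⟨U, V, hU, hV, hxU, h0V, hUV⟩ := t2_separation hx0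
  have hfin : {i | f i ∉ V}.Finite := h.eventually (hV.mem_nhds h0V)
  have hinf := hx.nhds_inter (hU.mem_nhds hxU)
  refine Set.not_infinite.2 ((hfin.image f).subset ?_) (Set.Infinite.of_accPt hinf)
  rintro _ ⟨hyU, i, rfl⟩
  exact ⟨i, fun hV' => Set.disjoint_left.1 hUV hyU hV', rfl⟩

end TwistedCubicKleinian

theorem proposition6p1 (Γ : Subgroup PSL(2, ℂ))
    (hΓ : TwistedCubicKleinian.IsKleinian Γ)
    (hinf : OnePoint.infty ∈ TwistedCubicKleinian.discontinuitySet Γ) :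
    -- `det C_g ≠ 0` exactly for the images of the elements of `Γ` that do not fix `∞`
    (∀ γ ∈ Γ, TwistedCubicKleinian.NonsingularC (TwistedCubicKleinian.cubicRep γ) ↔
      TwistedCubicKleinian.moebius γ OnePoint.infty ≠ OnePoint.infty) ∧
    -- only finitely many elements of the image group have a singular block
    {g : PSL(4, ℂ) | g ∈ Γ.map TwistedCubicKleinian.cubicRep ∧
      ¬ TwistedCubicKleinian.NonsingularC g}.Finite ∧
    -- the series converges
    (∀ δ : ℝ, 4 ≤ δ →
      Summable (fun g : TwistedCubicKleinian.starSet (Γ.map TwistedCubicKleinian.cubicRep) =>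
        TwistedCubicKleinian.normInvC (g : PSL(4, ℂ)) ^ δ)) ∧
    TwistedCubicKleinian.ConditionClub (Γ.map TwistedCubicKleinian.cubicRep) ∧
    TwistedCubicKleinian.ConditionSpade (Γ.map TwistedCubicKleinian.cubicRep) := by
  have hs := TwistedCubicKleinian.summable_normInvC_starSet_pow_four Γ hinf
  have hnn (g : TwistedCubicKleinian.starSet (Γ.map TwistedCubicKleinian.cubicRep)) :=
    TwistedCubicKleinian.normInvC_nonneg (g : PSL(4, ℂ))
  have ht := TwistedCubicKleinian.tendsto_cofinite_zero_of_summable_pow hnn four_ne_zero hs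
  refine ⟨fun γ _ => TwistedCubicKleinian.nonsingularC_cubicRep_iff γ,
    TwistedCubicKleinian.finite_not_nonsingularC Γ hinf,
    fun δ hδ => TwistedCubicKleinian.summable_rpow_of_summable_pow hnn four_ne_zero hs
      (by exact_mod_cast hδ), ?_, fun x hx => ?_⟩
  · rw [TwistedCubicKleinian.ConditionClub, TwistedCubicKleinian.radiusSet, Set.image_eq_range]
    exact Metric.isBounded_range_of_tendsto_cofinite ht
  · rw [TwistedCubicKleinian.radiusSet, Set.image_eq_range] at hx
    exact TwistedCubicKleinian.eq_zero_of_accPt_range ht hx
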